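/- A diagram is a set $J\subseteq\mathbb Z^2$ with $J+\mathbb N^2\subseteq J$, where $\mathbb N=\{0,1,2,\dots\}$. Let $H_J$ be the closed subspace of $L^2(\mathbb T^2)$ of all $f$ whose Fourier coefficients $\hat f_{i,j}$ (with respect to $w^iz^j$) vanish for $(i,j)\notin J$, and let $M_w,M_z$ be the operators on $H_J$ of multiplication by the coordinates $w,z$. The Taylor spectrum $\sigma_T(T_1,T_2)$ of a commuting pair on a Hilbert space $\mathcal H$ is the set of $(\mu,\lambda)\in\mathbb C^2$ for which the Koszul complex $$0\to\mathcal H\xrightarrow{\ h\mapsto (A_1h,A_2h)\ }\mathcal H\oplus\mathcal H\xrightarrow{\ (h_1,h_2)\mapsto -A_2h_1+A_1h_2\ }\mathcal H\to 0,\qquad A_1=\mu-T_1,\ A_2=\lambda-T_2,$$ is not exact. For $j\in\mathbb Z$ put $M_j=\inf\{i\in\mathbb{Z}:(i,j)\in J\}\in\mathbb Z\cup\{\pm\infty\}$ (with $\inf\emptyset=\infty$). When all $M_j$ are integers, as for the diagrams below, let $$\rho_-=\lim_{n\to\infty}\sup_{j\le j_0}\frac{M_{j-n}-M_j}{n},\quad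 \delta_-=\lim_{n\to\infty}\inf_{j\le j_0}\frac{M_{j-n}-M_j}{n},$$ $$\rho_+=\lim_{n\to\infty}\sup_{j\ge j_1}\frac{M_j-M_{j+n}}{n},\quad \delta_+=\lim_{n\to\infty}\inf_{j\ge j_1}\frac{M_j-M_{j+n}}{n};$$ these limits do not depend on the choice of $j_0,j_1\in\mathbb Z$. (1) Let $\alpha>0$. Then $J=\{(i,j)\in\mathbb Z^2: j\ge-\alpha i\}$ is a diagram, $\rho_+=\rho_-=\delta_+=\delta_-=\frac1\alpha$, and $$\sigma_T(M_w,M_z)=\{(\mu,\lambda)\in\overline{\mathbb D}^2:|\lambda|^\alpha=|\mu|\},$$ which is a set of Lebesgue measure zero in $\mathbb C^2$. (2) Let $\beta>\alpha>0$. Then $J=\{(i,j)\in\mathbb Z^2: j\ge-\alpha i\text{ if } i\ge0,\ \text{and } j\ge-\beta i\text{ if } i<0\}$ is a diagram, $\rho_-=\delta_-=\frac1\alpha$, $\rho_+=\delta_+=\frac1\beta$, and $$\sigma_T(M_w,M_z)=\{(\mu,\lambda)\in\overline{\mathbb D}^2:|\lambda|^\beta\le|\mu|\le|\lambda|^\alpha\}.$$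 -/

import Mathlib

open MeasureTheory Filter Topology
open scoped ENNReal

noncomputable section

namespace DiagramPair

/-! ### Taylor spectrum of a pair of operators -/

section Taylor

variable {H : Type*} [NormedAddCommGroup H] [InnerProductSpace ℂ H]

/-- The first Koszul map `h ↦ (T₁ h, T₂ h)`. -/
def koszulD₁ (T₁ T₂ : H →L[ℂ] H) : H →L[ℂ] H × H := T₁.prod T₂

/-- The second Koszul map `(h₁, h₂) ↦ -T₂ h₁ + T₁ h₂`. -/
def koszulD₂ (T₁ T₂ : H →L[ℂ] H) : H × H →L[ℂ] H :=
  -(T₂ ∘L ContinuousLinearMap.fst ℂ H H) + T₁ ∘L ContinuousLinearMap.snd ℂ H H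

/-- Exactness, at all three places, of the Koszul complex `0 → H → H × H → H → 0`. -/
def KoszulExact (T₁ T₂ : H →L[ℂ] H) : Prop :=
  (koszulD₁ T₁ T₂).ker = ⊥ ∧
  (koszulD₂ T₁ T₂).ker = (koszulD₁ T₁ T₂).range ∧
  (koszulD₂ T₁ T₂).range = ⊤

/-- The Taylor spectrum of a (commuting) pair `(T₁, T₂)`. -/
def taylorSpectrum (T₁ T₂ : H →L[ℂ] H) : Set (ℂ × ℂ) :=
  {p | ¬ KoszulExact (p.1 • ContinuousLinearMap.id ℂ H - T₁)
    (p.2 • ContinuousLinearMap.id ℂ H - T₂)}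

end Taylor

/-! ### Diagrams and the operators they define -/

/-- A diagram: a subset `J` of `ℤ²` with `J + ℕ² ⊆ J`. -/
def IsDiagram (J : Set (ℤ × ℤ)) : Prop :=
  ∀ i j : ℤ, (i, j) ∈ J → ∀ k l : ℕ, (i + k, j + l) ∈ J

/-- The normalised Haar measure of the torus `𝕋²`, realised as `(ℝ / ℤ)²`; the coordinate functions
are `w = exp (2πi x₀)` and `z = exp (2πi x₁)`. -/
abbrev haarT2 : Measure (UnitAddTorus (Fin 2)) :=
  Measure.pi fun _ => (AddCircle.haarAddCircle : Measure UnitAddCircle)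

/-- The Hilbert space `L²(𝕋²)`. -/
abbrev L2T2 : Type := Lp ℂ 2 haarT2

/-- Multiplication by the monomial `w ^ i * z ^ j` on `L²(𝕋²)`. -/
def mulMonomial (i j : ℤ) : L2T2 →L[ℂ] L2T2 :=
  (ContinuousLinearMap.mul ℂ ℂ).holderL haarT2 ∞ 2 2
    (ContinuousMap.toLp ∞ haarT2 ℂ (UnitAddTorus.mFourier ![i, j]))

lemma mulMonomial_ae (i j : ℤ) (f : L2T2) :
    mulMonomial i j f =ᵐ[haarT2] fun x => UnitAddTorus.mFourier ![i, j] x * f x := by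
  have h := (ContinuousLinearMap.mul ℂ ℂ).coeFn_holder (r := 2)
    (ContinuousMap.toLp ∞ haarT2 ℂ (UnitAddTorus.mFourier ![i, j])) f
  have h2 := ContinuousMap.coeFn_toLp (p := ∞) (𝕜 := ℂ) haarT2
    (UnitAddTorus.mFourier ![i, j])
  refine h.trans ?_
  filter_upwards [h2] with x hx
  rw [hx]; rfl

/-- The Fourier coefficient of `f` at `w ^ i * z ^ j`. -/
def coeffT2 (f : L2T2) (i j : ℤ) : ℂ := UnitAddTorus.mFourierCoeff f ![i, j]

lemma coeffT2_eq (f : L2T2) (i j : ℤ) :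
    coeffT2 f i j = ∫ t, UnitAddTorus.mFourier ![-i, -j] t * f t ∂haarT2 := by
  have : -![i, j] = ![-i, -j] := by ext k; fin_cases k <;> rfl
  simp only [coeffT2, UnitAddTorus.mFourierCoeff, this]; rfl

lemma coeffT2_mulMonomial (a b : ℤ) (f : L2T2) (i j : ℤ) :
    coeffT2 (mulMonomial a b f) i j = coeffT2 f (i - a) (j - b) := by
  rw [coeffT2_eq, coeffT2_eq]
  apply integral_congr_ae
  filter_upwards [mulMonomial_ae a b f] with x hx
  have : ![-(i - a), -(j - b)] = ![-i, -j] + ![a, b] := by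
    ext k; fin_cases k <;> simp <;> ring
  rw [hx, this, UnitAddTorus.mFourier_add, mul_assoc]

lemma coeffT2_add (f g : L2T2) (i j : ℤ) :
    coeffT2 (f + g) i j = coeffT2 f i j + coeffT2 g i j := by
  have h (f : L2T2) : coeffT2 f i j = (UnitAddTorus.mFourierBasis.repr f) ![i, j] :=
    (UnitAddTorus.mFourierBasis_repr f ![i, j]).symm
  rw [h, h, h]
  exact congrArg (fun u => u ![i, j]) (map_add UnitAddTorus.mFourierBasis.repr f g)

lemma coeffT2_smul (c : ℂ) (f : L2T2) (i j : ℤ) :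
    coeffT2 (c • f) i j = c * coeffT2 f i j := by
  have h (f : L2T2) : coeffT2 f i j = (UnitAddTorus.mFourierBasis.repr f) ![i, j] :=
    (UnitAddTorus.mFourierBasis_repr f ![i, j]).symm
  rw [h, h]
  exact congrArg (fun u => u ![i, j]) (map_smul UnitAddTorus.mFourierBasis.repr c f)

/-- The space `H_J` of all `f ∈ L²(𝕋²)` whose Fourier coefficients vanish outside `J`. -/
def HJ (J : Set (ℤ × ℤ)) : Submodule ℂ L2T2 where
  carrier := {f | ∀ i j : ℤ, (i, j) ∉ J → coeffT2 f i j = 0}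
  add_mem' := by
    intro f g hf hg i j h
    rw [coeffT2_add, hf i j h, hg i j h, add_zero]
  zero_mem' := by
    intro i j _
    have := coeffT2_smul 0 0 i j
    simpa using this
  smul_mem' := by
    intro c f hf i j h
    rw [coeffT2_smul, hf i j h, mul_zero]

lemma mulMonomial_mem {J : Set (ℤ × ℤ)} (hJ : IsDiagram J) (k l : ℕ) :
    ∀ f ∈ HJ J, mulMonomial k l f ∈ HJ J := by
  intro f hf i j h
  rw [coeffT2_mulMonomial]
  refine hf _ _ fun h' => h ?_
  simpa using hJ _ _ h' k l

/-- The isometry `M_w` on `H_J`: multiplication by `w`. -/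
def Mw (J : Set (ℤ × ℤ)) (hJ : IsDiagram J) : HJ J →L[ℂ] HJ J :=
  (mulMonomial 1 0).restrict (mulMonomial_mem hJ 1 0)

/-- The isometry `M_z` on `H_J`: multiplication by `z`. -/
def Mz (J : Set (ℤ × ℤ)) (hJ : IsDiagram J) : HJ J →L[ℂ] HJ J :=
  (mulMonomial 0 1).restrict (mulMonomial_mem hJ 0 1)

lemma mulMonomial_comm (a b c d : ℤ) (f : L2T2) :
    mulMonomial a b (mulMonomial c d f) = mulMonomial c d (mulMonomial a b f) := by
  apply Lp.ext
  filter_upwards [mulMonomial_ae a b (mulMonomial c d f), mulMonomial_ae c d f,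
    mulMonomial_ae c d (mulMonomial a b f), mulMonomial_ae a b f] with x h1 h2 h3 h4
  rw [h1, h2, h3, h4]
  ring

/-- The pair `(M_w, M_z)` is commuting. -/
lemma Mw_Mz_commute (J : Set (ℤ × ℤ)) (hJ : IsDiagram J) : Commute (Mw J hJ) (Mz J hJ) := by
  refine ContinuousLinearMap.ext fun f => Subtype.ext ?_
  exact mulMonomial_comm 1 0 0 1 f

/-! ### The parameters of a diagram -/

/-- `M_j = inf {i : (i, j) ∈ J}` in `ℤ ∪ {-∞, ∞}`; it is `∞` when that set is empty. -/
def rowStart (J : Set (ℤ × ℤ)) (j : ℤ) : EReal :=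
  ⨅ i : {i : ℤ // (i, j) ∈ J}, (((i : ℤ) : ℝ) : EReal)

/-- `M_j` is an integer. -/
def RowFinite (J : Set (ℤ × ℤ)) (j : ℤ) : Prop := rowStart J j ≠ ⊥ ∧ rowStart J j ≠ ⊤

/-- `ρ₋ = r`: either some `M_j = ∞` and `r = ∞`, or no `M_j = ∞`, all `M_j` far down are integers,
and `r` is the limit of `sup_{j ≤ j₀} (M_{j-n} - M_j) / n`, whatever admissible base row `j₀` is
used (a change of `j₀` amounts to a translation of the diagram). -/
def IsRhoMinus (J : Set (ℤ × ℤ)) (r : EReal) : Prop :=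
  ((∃ j, rowStart J j = ⊤) ∧ r = ⊤) ∨
  ((∀ j, rowStart J j ≠ ⊤) ∧ (∃ j₀, ∀ j ≤ j₀, RowFinite J j) ∧
    ∀ j₀, (∀ j ≤ j₀, RowFinite J j) →
      Tendsto (fun n : ℕ => ⨆ j : {j : ℤ // j ≤ j₀},
        (rowStart J (j - n) - rowStart J j) / (n : EReal)) atTop (𝓝 r))

/-- `δ₋ = r`: as for `ρ₋`, with the infimum in place of the supremum. -/
def IsDeltaMinus (J : Set (ℤ × ℤ)) (r : EReal) : Prop :=
  ((∃ j, rowStart J j = ⊤) ∧ r = ⊤) ∨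
  ((∀ j, rowStart J j ≠ ⊤) ∧ (∃ j₀, ∀ j ≤ j₀, RowFinite J j) ∧
    ∀ j₀, (∀ j ≤ j₀, RowFinite J j) →
      Tendsto (fun n : ℕ => ⨅ j : {j : ℤ // j ≤ j₀},
        (rowStart J (j - n) - rowStart J j) / (n : EReal)) atTop (𝓝 r))

/-- `ρ₊ = r`: either some `M_j = -∞` and `r = ∞`, or no `M_j = -∞`, all `M_j` far up are integers,
and `r` is the limit of `sup_{j ≥ j₁} (M_j - M_{j+n}) / n` for every admissible base row `j₁`. -/
def IsRhoPlus (J : Set (ℤ × ℤ)) (r : EReal) : Prop :=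
  ((∃ j, rowStart J j = ⊥) ∧ r = ⊤) ∨
  ((∀ j, rowStart J j ≠ ⊥) ∧ (∃ j₁, ∀ j ≥ j₁, RowFinite J j) ∧
    ∀ j₁, (∀ j ≥ j₁, RowFinite J j) →
      Tendsto (fun n : ℕ => ⨆ j : {j : ℤ // j ≥ j₁},
        (rowStart J j - rowStart J (j + n)) / (n : EReal)) atTop (𝓝 r))

/-- `δ₊ = r`: as for `ρ₊`, with the infimum in place of the supremum. -/
def IsDeltaPlus (J : Set (ℤ × ℤ)) (r : EReal) : Prop :=
  ((∃ j, rowStart J j = ⊥) ∧ r = ⊤) ∨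
  ((∀ j, rowStart J j ≠ ⊥) ∧ (∃ j₁, ∀ j ≥ j₁, RowFinite J j) ∧
    ∀ j₁, (∀ j ≥ j₁, RowFinite J j) →
      Tendsto (fun n : ℕ => ⨅ j : {j : ℤ // j ≥ j₁},
        (rowStart J j - rowStart J (j + n)) / (n : EReal)) atTop (𝓝 r))

/-! ### The two families of diagrams -/

/-- The set `{(i, j) : j ≥ -α i}`. -/
def lineDiagram (α : ℝ) : Set (ℤ × ℤ) := {p | (p.2 : ℝ) ≥ -α * p.1}

/-- The set of all `(i, j)` with `j ≥ -α i` if `i ≥ 0`, and `j ≥ -β i` if `i < 0`. -/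
def twoLineDiagram (α β : ℝ) : Set (ℤ × ℤ) :=
  {p | (0 ≤ p.1 → (p.2 : ℝ) ≥ -α * p.1) ∧ (p.1 < 0 → (p.2 : ℝ) ≥ -β * p.1)}

end DiagramPair

end

namespace DiagramPair

/-! ### Exactness criteria for the Koszul complex -/

section Koszul

variable {H : Type*} [NormedAddCommGroup H] [InnerProductSpace ℂ H]

/-! Both families are wedges `J = {α i + j ≥ 0, β i + j ≥ 0}` with `α ≤ β`; the half plane is the
case `α = β`. The spectrum is computed once for the wedge, by two opposite arguments.

Outside the claimed set: if `q ≤ α p`, multiplication by `w ^ p * z ^ (-q)` maps `H_J` to itself, so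
`M_w ^ p = S * M_z ^ q` with `S` a commuting contraction. When `‖l‖ ^ q < ‖μ‖ ^ p`, the operator `μ
^ p - l ^ q S = (μ ^ p - M_w ^ p) - S (l ^ q - M_z ^ q)` is invertible. Factoring both differences
gives a Bézout identity in the commutant, hence exactness (`exists_bezout`,
`koszulExact_of_bezout`). If `q ≥ β p`, the roles of `w` and `z` are exchanged. Rational
approximation of `α` and `β` reaches every excluded point of the bidisc.

Inside the set: the adjoints act as backward shifts, so `conj μ ^ i * conj l ^ j` on `J` is a formal
joint eigenvector. The two inequalities say exactly what bounds these coefficients by 1 on `J`;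
slowly decaying weights make them square summable at the cost of a small relative error. By the open
mapping theorem the last Koszul map is then not onto (`not_koszulExact_of_adjoint`). The origin is
treated separately, with the basis vector at the corner of `J`.

The growth parameters follow because `M_j` stays within bounded distance of `-j / α` below any fixed
row and of `-j / β` above it. -/

/-- A Bézout identity with coefficients in the commutant makes the Koszul complex exact. -/
lemma koszulExact_of_bezout {A₁ A₂ B₁ B₂ : H →L[ℂ] H} (hA : Commute A₁ A₂)
    (h₁₁ : Commute B₁ A₁) (h₁₂ : Commute B₁ A₂) (h₂₁ : Commute B₂ A₁) (h₂₂ : Commute B₂ A₂)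
    (h : B₁ * A₁ + B₂ * A₂ = 1) : KoszulExact A₁ A₂ := by
  have key (x : H) : B₁ (A₁ x) + B₂ (A₂ x) = x := by
    simpa using DFunLike.congr_fun h x
  have cA (x : H) : A₁ (A₂ x) = A₂ (A₁ x) := DFunLike.congr_fun hA.eq x
  have c₁₁ (x : H) : B₁ (A₁ x) = A₁ (B₁ x) := DFunLike.congr_fun h₁₁.eq x
  have c₁₂ (x : H) : B₁ (A₂ x) = A₂ (B₁ x) := DFunLike.congr_fun h₁₂.eq x
  have c₂₁ (x : H) : B₂ (A₁ x) = A₁ (B₂ x) := DFunLike.congr_fun h₂₁.eq x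
  have c₂₂ (x : H) : B₂ (A₂ x) = A₂ (B₂ x) := DFunLike.congr_fun h₂₂.eq x
  refine ⟨?_, ?_, ?_⟩
  · rw [eq_bot_iff]
    intro x hx
    have hx' : (A₁ x, A₂ x) = 0 := hx
    rw [Prod.mk_eq_zero] at hx'
    have := key x
    rw [hx'.1, hx'.2, map_zero, map_zero, add_zero] at this
    exact this.symm
  · ext ⟨x, y⟩
    constructor
    · intro hx
      have hx' : -A₂ x + A₁ y = 0 := hx
      have e : A₁ y = A₂ x := by rwa [neg_add_eq_zero, eq_comm] at hx'
      -- Since `A₁ y = A₂ x`, applying `A₁` gives `B₁ A₁ x + B₂ A₂ x = x`; likewise `A₂` gives `y`.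
      refine ⟨B₁ x + B₂ y, ?_⟩
      change (A₁ (B₁ x + B₂ y), A₂ (B₁ x + B₂ y)) = (x, y)
      rw [map_add, map_add, ← c₁₁, ← c₂₁, ← c₁₂, ← c₂₂, e, key, ← e, key]
    · rintro ⟨u, hu⟩
      have hu' : (A₁ u, A₂ u) = (x, y) := hu
      rw [Prod.mk.injEq] at hu'
      change -A₂ x + A₁ y = 0
      rw [← hu'.1, ← hu'.2, cA, neg_add_cancel]
  · rw [eq_top_iff]
    intro x _
    refine ⟨(-B₂ x, B₁ x), ?_⟩
    change -A₂ (-B₂ x) + A₁ (B₁ x) = x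
    rw [map_neg, neg_neg, ← c₁₁, ← c₂₂, add_comm, key]

/-- An approximate joint eigenvector of the adjoints obstructs exactness. -/
lemma not_koszulExact_of_adjoint [CompleteSpace H] {A₁ A₂ : H →L[ℂ] H}
    (h : ∀ ε > 0, ∃ v : H, v ≠ 0 ∧ ‖A₁.adjoint v‖ ≤ ε * ‖v‖ ∧ ‖A₂.adjoint v‖ ≤ ε * ‖v‖) :
    ¬ KoszulExact A₁ A₂ := by
  rintro ⟨-, -, hs⟩
  obtain ⟨C, hC, hpre⟩ :=
    (koszulD₂ A₁ A₂).exists_preimage_norm_le (LinearMap.range_eq_top.1 hs)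
  -- With this `ε`, each of the two terms bounding `‖v‖ ^ 2` below is at most `‖v‖ ^ 2 / 4`, a
  -- contradiction.
  obtain ⟨v, hv, h₁, h₂⟩ := h (1 / (4 * C)) (by positivity)
  obtain ⟨⟨x, y⟩, hxy, hle⟩ := hpre v
  have hvpos : 0 < ‖v‖ := norm_pos_iff.2 hv
  have hx : ‖x‖ ≤ C * ‖v‖ := (norm_fst_le (x, y)).trans hle
  have hy : ‖y‖ ≤ C * ‖v‖ := (norm_snd_le (x, y)).trans hle
  have e : inner ℂ v v = -inner ℂ (A₂.adjoint v) x + inner ℂ (A₁.adjoint v) y := by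
    rw [ContinuousLinearMap.adjoint_inner_left, ContinuousLinearMap.adjoint_inner_left,
      ← inner_neg_right, ← inner_add_right]
    exact congrArg _ hxy.symm
  have e' : ‖v‖ ^ 2 ≤ ‖A₂.adjoint v‖ * ‖x‖ + ‖A₁.adjoint v‖ * ‖y‖ := by
    have : ‖(inner ℂ v v : ℂ)‖ = ‖v‖ ^ 2 := by
      rw [inner_self_eq_norm_sq_to_K]; simp
    rw [← this, e]
    refine (norm_add_le _ _).trans ?_
    rw [norm_neg]
    exact add_le_add (norm_inner_le_norm _ _) (norm_inner_le_norm _ _)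
  have hb (a b : ℝ) (ha0 : 0 ≤ b) (ha : a ≤ 1 / (4 * C) * ‖v‖) (hb : b ≤ C * ‖v‖) :
      a * b ≤ ‖v‖ ^ 2 / 4 := by
    calc a * b ≤ (1 / (4 * C) * ‖v‖) * (C * ‖v‖) :=
          mul_le_mul ha hb ha0 (by positivity)
      _ = ‖v‖ ^ 2 / 4 := by field_simp
  have := hb _ _ (norm_nonneg _) h₂ hx
  have := hb _ _ (norm_nonneg _) h₁ hy
  nlinarith [pow_pos hvpos 2]

/-- The element `a - b` is invertible, with inverse in the commutant, when `‖b‖ < ‖a‖` for a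
scalar `a`. -/
lemma exists_commuting_inverse [CompleteSpace H] {a : ℂ} {b : H →L[ℂ] H} (h : ‖b‖ < ‖a‖) :
    ∃ S : H →L[ℂ] H, S * (a • (1 : H →L[ℂ] H) - b) = 1 ∧ ∀ X, Commute X b → Commute S X := by
  have ha : a ≠ 0 := by
    rintro rfl
    rw [norm_zero] at h
    exact (norm_nonneg b).not_gt h
  have hu : IsUnit (a • (1 : H →L[ℂ] H) - b) := by
    have h1 : ‖a⁻¹ • b‖ < 1 := by
      rw [norm_smul, norm_inv, inv_mul_lt_iff₀ (norm_pos_iff.2 ha), mul_one]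
      exact h
    have := (isUnit_one_sub_of_norm_lt_one h1).smul (Units.mk0 a ha)
    convert this using 1
    rw [Units.smul_def, Units.val_mk0, smul_sub, smul_smul, mul_inv_cancel₀ ha, one_smul]
  obtain ⟨u, hu⟩ := hu
  refine ⟨↑u⁻¹, by rw [← hu, Units.inv_mul], fun X hX => ?_⟩
  have : Commute (↑u) X := by
    rw [hu]
    exact (((Commute.one_left X).smul_left a).sub_left hX.symm)
  exact this.units_inv_left

variable {T₁ T₂ : H →L[ℂ] H}

lemma commute_shift (hT : Commute T₁ T₂) (μ l : ℂ) :
    Commute (μ • ContinuousLinearMap.id ℂ H - T₁) (l • ContinuousLinearMap.id ℂ H - T₂) := by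
  have h1 (a : ℂ) (X : H →L[ℂ] H) : Commute (a • ContinuousLinearMap.id ℂ H) X :=
    (Commute.one_left X).smul_left a
  exact ((h1 _ _).sub_right (h1 _ _)).sub_left (((h1 _ _).symm).sub_right hT)

variable [CompleteSpace H]

/-- If `T₁ ^ p = S * T₂ ^ q` with `S` a commuting contraction, then points with
`‖l‖ ^ q < ‖μ‖ ^ p` satisfy a Bézout identity in the commutant. -/
lemma exists_bezout {S : H →L[ℂ] H} (hS : ‖S‖ ≤ 1) {p q : ℕ} (hpq : T₁ ^ p = S * T₂ ^ q) {μ l : ℂ}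
    (hlt : ‖l‖ ^ q < ‖μ‖ ^ p) :
    ∃ B₁ B₂ : H →L[ℂ] H, (∀ X, Commute X T₁ → Commute X T₂ → Commute X S →
        Commute B₁ X ∧ Commute B₂ X) ∧
      B₁ * (μ • ContinuousLinearMap.id ℂ H - T₁) +
        B₂ * (l • ContinuousLinearMap.id ℂ H - T₂) = 1 := by
  have hb : ‖l ^ q • S‖ < ‖μ ^ p‖ := by
    rw [norm_smul, norm_pow, norm_pow]
    exact (mul_le_of_le_one_right (by positivity) hS).trans_lt hlt
  -- `V` inverts `μ ^ p - l ^ q S`; the geometric sums `C` and `D` below are the cofactors of `μ -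
  -- T₁` in `μ ^ p - T₁ ^ p` and of `l - T₂` in `l ^ q - T₂ ^ q`.
  obtain ⟨V, hV, hVc⟩ := exists_commuting_inverse hb
  have hsc (a : ℂ) (X : H →L[ℂ] H) : Commute (a • (1 : H →L[ℂ] H)) X :=
    (Commute.one_left X).smul_left a
  set C := ∑ i ∈ Finset.range p, (μ • (1 : H →L[ℂ] H)) ^ i * T₁ ^ (p - 1 - i) with hC
  set D := ∑ i ∈ Finset.range q, (l • (1 : H →L[ℂ] H)) ^ i * T₂ ^ (q - 1 - i) with hD
  have hC' : C * (μ • (1 : H →L[ℂ] H) - T₁) = μ ^ p • (1 : H →L[ℂ] H) - T₁ ^ p := by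
    rw [hC, (hsc μ T₁).geom_sum₂_mul p, smul_pow, one_pow]
  have hD' : D * (l • (1 : H →L[ℂ] H) - T₂) = l ^ q • (1 : H →L[ℂ] H) - T₂ ^ q := by
    rw [hD, (hsc l T₂).geom_sum₂_mul q, smul_pow, one_pow]
  refine ⟨V * C, -(V * S * D), fun X h₁ h₂ hS' => ?_, ?_⟩
  · have hVX : Commute V X := hVc X (hS'.smul_right _)
    refine ⟨hVX.mul_left ?_, ((hVX.mul_left hS'.symm).mul_left ?_).neg_left⟩
    · exact Commute.sum_left _ _ _ fun i _ => ((hsc μ X).pow_left i).mul_left (h₁.symm.pow_left _)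
    · exact Commute.sum_left _ _ _ fun i _ => ((hsc l X).pow_left i).mul_left (h₂.symm.pow_left _)
  · change V * C * (μ • (1 : H →L[ℂ] H) - T₁) + -(V * S * D) * (l • (1 : H →L[ℂ] H) - T₂) = 1
    refine Eq.trans ?_ hV
    rw [neg_mul, mul_assoc, mul_assoc, hC', hD', mul_assoc, ← mul_neg, ← mul_add, hpq, mul_sub S,
      mul_smul_comm, mul_one]
    congr 1
    abel

lemma koszulExact_of_pow_lt_left {S : H →L[ℂ] H} (hT : Commute T₁ T₂) (hS₁ : Commute S T₁)
    (hS₂ : Commute S T₂) (hS : ‖S‖ ≤ 1) {p q : ℕ} (hpq : T₁ ^ p = S * T₂ ^ q) {μ l : ℂ}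
    (hlt : ‖l‖ ^ q < ‖μ‖ ^ p) :
    KoszulExact (μ • ContinuousLinearMap.id ℂ H - T₁) (l • ContinuousLinearMap.id ℂ H - T₂) := by
  have hsc (a : ℂ) (X : H →L[ℂ] H) : Commute (a • ContinuousLinearMap.id ℂ H) X :=
    (Commute.one_left X).smul_left a
  obtain ⟨B₁, B₂, hB, e⟩ := exists_bezout hS hpq hlt
  have c₁ := hB _ ((hsc μ T₁).sub_left (Commute.refl T₁)) ((hsc μ T₂).sub_left hT)
    ((hsc μ S).sub_left hS₁.symm)
  have c₂ := hB _ ((hsc l T₁).sub_left hT.symm) ((hsc l T₂).sub_left (Commute.refl T₂))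
    ((hsc l S).sub_left hS₂.symm)
  exact koszulExact_of_bezout (commute_shift hT μ l) c₁.1 c₂.1 c₁.2 c₂.2 e

lemma koszulExact_of_pow_lt_right {S : H →L[ℂ] H} (hT : Commute T₁ T₂) (hS₁ : Commute S T₁)
    (hS₂ : Commute S T₂) (hS : ‖S‖ ≤ 1) {p q : ℕ} (hpq : T₂ ^ q = S * T₁ ^ p) {μ l : ℂ}
    (hlt : ‖μ‖ ^ p < ‖l‖ ^ q) :
    KoszulExact (μ • ContinuousLinearMap.id ℂ H - T₁) (l • ContinuousLinearMap.id ℂ H - T₂) := by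
  have hsc (a : ℂ) (X : H →L[ℂ] H) : Commute (a • ContinuousLinearMap.id ℂ H) X :=
    (Commute.one_left X).smul_left a
  obtain ⟨B₂, B₁, hB, e⟩ := exists_bezout hS hpq hlt
  have c₁ := hB _ ((hsc μ T₂).sub_left hT) ((hsc μ T₁).sub_left (Commute.refl T₁))
    ((hsc μ S).sub_left hS₁.symm)
  have c₂ := hB _ ((hsc l T₂).sub_left (Commute.refl T₂)) ((hsc l T₁).sub_left hT.symm)
    ((hsc l S).sub_left hS₂.symm)
  exact koszulExact_of_bezout (commute_shift hT μ l) c₁.2 c₂.2 c₁.1 c₂.1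
    (by rw [add_comm]; exact e)

end Koszul

/-! ### Fourier coefficients -/

lemma coeffT2_eq_repr (f : L2T2) (i j : ℤ) :
    coeffT2 f i j = UnitAddTorus.mFourierBasis.repr f ![i, j] :=
  (UnitAddTorus.mFourierBasis_repr f ![i, j]).symm

lemma repr_eq_coeffT2 (f : L2T2) (n : Fin 2 → ℤ) :
    UnitAddTorus.mFourierBasis.repr f n = coeffT2 f (n 0) (n 1) := by
  rw [coeffT2_eq_repr]
  exact congrArg _ (by ext k; fin_cases k <;> rfl)

lemma ext_coeffT2 {f g : L2T2} (h : ∀ i j, coeffT2 f i j = coeffT2 g i j) : f = g := by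
  apply UnitAddTorus.mFourierBasis.repr.injective
  ext n
  rw [repr_eq_coeffT2, repr_eq_coeffT2, h]

lemma coeffT2_sub (f g : L2T2) (i j : ℤ) :
    coeffT2 (f - g) i j = coeffT2 f i j - coeffT2 g i j := by
  rw [sub_eq_add_neg, ← neg_one_smul ℂ g, coeffT2_add, coeffT2_smul]
  ring

lemma continuous_coeffT2 (i j : ℤ) : Continuous fun f : L2T2 => coeffT2 f i j := by
  simp only [coeffT2_eq_repr, HilbertBasis.repr_apply_apply]
  exact continuous_const.inner continuous_id

/-- Parseval: a coefficientwise bound passes to the norm, so approximate eigenvectors can be checked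
one coefficient at a time. -/
lemma norm_le_of_coeffT2_le {f g : L2T2} {c : ℝ} (hc : 0 ≤ c)
    (h : ∀ i j, ‖coeffT2 f i j‖ ≤ c * ‖coeffT2 g i j‖) : ‖f‖ ≤ c * ‖g‖ := by
  rw [← UnitAddTorus.mFourierBasis.repr.norm_map f, ← UnitAddTorus.mFourierBasis.repr.norm_map g]
  have h2 : 0 < (2 : ℝ≥0∞).toReal := by norm_num
  refine lp.norm_le_of_forall_sum_le h2 (by positivity) fun s => ?_
  rw [Real.mul_rpow hc (norm_nonneg _)]
  refine le_trans ?_ (mul_le_mul_of_nonneg_left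
    (lp.sum_rpow_le_norm_rpow h2 (UnitAddTorus.mFourierBasis.repr g) s) (by positivity))
  rw [Finset.mul_sum]
  refine Finset.sum_le_sum fun n _ => ?_
  rw [← Real.mul_rpow hc (norm_nonneg _), repr_eq_coeffT2, repr_eq_coeffT2]
  exact Real.rpow_le_rpow (norm_nonneg _) (h _ _) h2.le

lemma exists_coeffT2_eq {c : ℤ → ℤ → ℂ}
    (hc : Summable fun n : ℤ × ℤ => ‖c n.1 n.2‖ ^ 2) :
    ∃ f : L2T2, ∀ i j, coeffT2 f i j = c i j := by
  have hm : Memℓp (fun n : Fin 2 → ℤ => c (n 0) (n 1)) 2 := by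
    apply memℓp_gen
    have := (Equiv.summable_iff (finTwoArrowEquiv ℤ)).2 hc
    refine this.congr fun n => ?_
    simp [finTwoArrowEquiv]
  refine ⟨UnitAddTorus.mFourierBasis.repr.symm ⟨_, hm⟩, fun i j => ?_⟩
  rw [coeffT2_eq_repr, LinearIsometryEquiv.apply_symm_apply]
  rfl

lemma mulMonomial_mulMonomial (a b c d : ℤ) (f : L2T2) :
    mulMonomial a b (mulMonomial c d f) = mulMonomial (a + c) (b + d) f := by
  refine ext_coeffT2 fun i j => ?_
  simp only [coeffT2_mulMonomial]
  congr 1 <;> ring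

lemma mulMonomial_zero_zero (f : L2T2) : mulMonomial 0 0 f = f := by
  refine ext_coeffT2 fun i j => ?_
  simp only [coeffT2_mulMonomial, sub_zero]

lemma norm_mulMonomial_le (a b : ℤ) (f : L2T2) : ‖mulMonomial a b f‖ ≤ ‖f‖ := by
  refine Lp.norm_le_norm_of_ae_le ?_
  filter_upwards [mulMonomial_ae a b f] with x hx
  rw [hx, norm_mul]
  refine mul_le_of_le_one_left (norm_nonneg _) ?_
  exact ((UnitAddTorus.mFourier ![a, b]).norm_coe_le_norm x).trans UnitAddTorus.mFourier_norm.le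

/-! ### Monomial shifts on `H_J` -/

section Shift

variable {J : Set (ℤ × ℤ)}

instance completeSpace_HJ : CompleteSpace (HJ J) := by
  have : IsClosed (HJ J : Set L2T2) := by
    have : (HJ J : Set L2T2) = ⋂ (i : ℤ) (j : ℤ) (_ : (i, j) ∉ J), {f | coeffT2 f i j = 0} := by
      ext f
      simp only [Set.mem_iInter]
      rfl
    rw [this]
    exact isClosed_iInter fun i => isClosed_iInter fun j => isClosed_iInter fun _ =>
      isClosed_eq (continuous_coeffT2 i j) continuous_const
  exact this.completeSpace_coe

/-- `(a, b) + J ⊆ J`. -/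
def ShiftsInto (J : Set (ℤ × ℤ)) (a b : ℤ) : Prop := ∀ i j, (i, j) ∈ J → (i + a, j + b) ∈ J

lemma ShiftsInto.mulMonomial_mem {a b : ℤ} (h : ShiftsInto J a b) :
    ∀ f ∈ HJ J, mulMonomial a b f ∈ HJ J := by
  intro f hf i j hij
  rw [coeffT2_mulMonomial]
  refine hf _ _ fun h' => hij ?_
  simpa using h _ _ h'

/-- Multiplication by `w ^ a * z ^ b` on `H_J`. -/
noncomputable def shiftHJ {a b : ℤ} (h : ShiftsInto J a b) : HJ J →L[ℂ] HJ J :=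
  (mulMonomial a b).restrict h.mulMonomial_mem

lemma coe_shiftHJ {a b : ℤ} (h : ShiftsInto J a b) (f : HJ J) :
    (shiftHJ h f : L2T2) = mulMonomial a b f := rfl

lemma norm_shiftHJ_le {a b : ℤ} (h : ShiftsInto J a b) : ‖shiftHJ h‖ ≤ 1 := by
  refine ContinuousLinearMap.opNorm_le_bound _ zero_le_one fun f => ?_
  rw [one_mul]
  exact norm_mulMonomial_le a b f

lemma shiftHJ_commute {a b c d : ℤ} (h : ShiftsInto J a b) (h' : ShiftsInto J c d) :
    Commute (shiftHJ h) (shiftHJ h') := by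
  refine ContinuousLinearMap.ext fun f => Subtype.ext ?_
  exact mulMonomial_comm a b c d f

lemma coe_shiftHJ_pow {a b : ℤ} (h : ShiftsInto J a b) (n : ℕ) (f : HJ J) :
    ((shiftHJ h ^ n) f : L2T2) = mulMonomial (n * a) (n * b) f := by
  induction n with
  | zero => simp [mulMonomial_zero_zero]
  | succ n ih =>
    rw [pow_succ', mul_apply_eq_comp, coe_shiftHJ, ih, mulMonomial_mulMonomial]
    congr 2 <;> push_cast <;> ring

lemma IsDiagram.shiftsInto (hJ : IsDiagram J) (k l : ℕ) : ShiftsInto J k l :=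
  fun i j h => hJ i j h k l

lemma Mw_eq (hJ : IsDiagram J) : Mw J hJ = shiftHJ (hJ.shiftsInto 1 0) := rfl

lemma Mz_eq (hJ : IsDiagram J) : Mz J hJ = shiftHJ (hJ.shiftsInto 0 1) := rfl

/-! ### Points excluded by monomial shifts -/

lemma Mw_pow_eq (hJ : IsDiagram J) {p q : ℕ} (h : ShiftsInto J p (-q)) :
    Mw J hJ ^ p = shiftHJ h * Mz J hJ ^ q := by
  refine ContinuousLinearMap.ext fun f => Subtype.ext ?_
  rw [Mw_eq, Mz_eq, mul_apply_eq_comp, coe_shiftHJ, coe_shiftHJ_pow, coe_shiftHJ_pow,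
    mulMonomial_mulMonomial]
  congr 2 <;> push_cast <;> ring

lemma Mz_pow_eq (hJ : IsDiagram J) {p q : ℕ} (h : ShiftsInto J (-p) q) :
    Mz J hJ ^ q = shiftHJ h * Mw J hJ ^ p := by
  refine ContinuousLinearMap.ext fun f => Subtype.ext ?_
  rw [Mw_eq, Mz_eq, mul_apply_eq_comp, coe_shiftHJ, coe_shiftHJ_pow, coe_shiftHJ_pow,
    mulMonomial_mulMonomial]
  congr 2 <;> push_cast <;> ring

lemma notMem_taylorSpectrum_of_shift_left (hJ : IsDiagram J) {p q : ℕ}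
    (h : ShiftsInto J p (-q)) {μ l : ℂ} (hlt : ‖l‖ ^ q < ‖μ‖ ^ p) :
    (μ, l) ∉ taylorSpectrum (Mw J hJ) (Mz J hJ) :=
  not_not.2 (koszulExact_of_pow_lt_left (Mw_Mz_commute J hJ) (shiftHJ_commute h (hJ.shiftsInto 1 0))
    (shiftHJ_commute h (hJ.shiftsInto 0 1)) (norm_shiftHJ_le h) (Mw_pow_eq hJ h) hlt)

lemma notMem_taylorSpectrum_of_shift_right (hJ : IsDiagram J) {p q : ℕ}
    (h : ShiftsInto J (-p) q) {μ l : ℂ} (hlt : ‖μ‖ ^ p < ‖l‖ ^ q) :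
    (μ, l) ∉ taylorSpectrum (Mw J hJ) (Mz J hJ) :=
  not_not.2 (koszulExact_of_pow_lt_right (Mw_Mz_commute J hJ) (shiftHJ_commute h (hJ.shiftsInto 1 0))
    (shiftHJ_commute h (hJ.shiftsInto 0 1)) (norm_shiftHJ_le h) (Mz_pow_eq hJ h) hlt)

lemma taylorSpectrum_subset_bidisc (hJ : IsDiagram J) {μ l : ℂ}
    (h : (μ, l) ∈ taylorSpectrum (Mw J hJ) (Mz J hJ)) : ‖μ‖ ≤ 1 ∧ ‖l‖ ≤ 1 := by
  refine ⟨?_, ?_⟩ <;> by_contra! hlt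
  -- The exponents `(1, 0)` make the criterion read `1 < ‖μ‖`.
  · refine notMem_taylorSpectrum_of_shift_left hJ (p := 1) (q := 0) ?_ (by simpa using hlt) h
    simpa using hJ.shiftsInto 1 0
  · refine notMem_taylorSpectrum_of_shift_right hJ (p := 0) (q := 1) ?_ (by simpa using hlt) h
    simpa using hJ.shiftsInto 0 1

/-! ### Adjoints of shifts and approximate eigenvectors -/

lemma exists_basisVector {i j : ℤ} (h : (i, j) ∈ J) :
    ∃ e : HJ J, (∀ f : L2T2, inner ℂ (e : L2T2) f = coeffT2 f i j) ∧
      ∀ k m, coeffT2 e k m = if (k, m) = (i, j) then 1 else 0 := by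
  let b := UnitAddTorus.mFourierBasis (d := Fin 2)
  have hc (k m : ℤ) : coeffT2 (b ![i, j]) k m = if (k, m) = (i, j) then 1 else 0 := by
    rw [coeffT2_eq_repr, HilbertBasis.repr_apply_apply,
      orthonormal_iff_ite.1 UnitAddTorus.mFourierBasis.orthonormal]
    refine if_congr ?_ rfl rfl
    simp [funext_iff, Fin.forall_fin_two]
  refine ⟨⟨b ![i, j], fun k m hkm => ?_⟩, fun f => ?_, hc⟩
  · rw [hc, if_neg]
    rintro e
    exact hkm (e ▸ h)
  · exact (HilbertBasis.repr_apply_apply b f ![i, j]).symm.trans (coeffT2_eq_repr f i j).symm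

/-- Pair with the basis vector at `(i, j)`: the shift sends it to the basis vector at `(i + a, j +
b)`. So the adjoint is the backward shift on `J`. -/
lemma coeffT2_adjoint_shiftHJ {a b : ℤ} (h : ShiftsInto J a b) (f : HJ J) {i j : ℤ}
    (hij : (i, j) ∈ J) :
    coeffT2 ((shiftHJ h).adjoint f : HJ J) i j = coeffT2 f (i + a) (j + b) := by
  obtain ⟨e, he, hec⟩ := exists_basisVector hij
  obtain ⟨e', he', hec'⟩ := exists_basisVector (h i j hij)
  have hse : shiftHJ h e = e' := by
    refine Subtype.ext (ext_coeffT2 fun k m => ?_)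
    rw [coe_shiftHJ, coeffT2_mulMonomial, hec, hec']
    refine if_congr ?_ rfl rfl
    rw [Prod.mk.injEq, Prod.mk.injEq, sub_eq_iff_eq_add, sub_eq_iff_eq_add]
  rw [← he, ← he', ← Submodule.coe_inner, ← Submodule.coe_inner,
    ContinuousLinearMap.adjoint_inner_right, hse]

lemma adjoint_smul_id_sub {H : Type*} [NormedAddCommGroup H] [InnerProductSpace ℂ H]
    [CompleteSpace H] (μ : ℂ) (T : H →L[ℂ] H) (v : H) :
    (μ • ContinuousLinearMap.id ℂ H - T).adjoint v = (starRingEnd ℂ) μ • v - T.adjoint v := by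
  rw [map_sub, LinearIsometryEquiv.map_smulₛₗ, ContinuousLinearMap.adjoint_id]
  rfl

lemma norm_adjoint_sub_shiftHJ_le {a b : ℤ} (h : ShiftsInto J a b) (μ : ℂ) {v : HJ J} {ε : ℝ}
    (hε : 0 ≤ ε) (hv : ∀ i j, (i, j) ∈ J →
      ‖(starRingEnd ℂ) μ * coeffT2 v i j - coeffT2 v (i + a) (j + b)‖ ≤ ε * ‖coeffT2 v i j‖) :
    ‖(μ • ContinuousLinearMap.id ℂ (HJ J) - shiftHJ h).adjoint v‖ ≤ ε * ‖v‖ := by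
  refine norm_le_of_coeffT2_le (f := ((μ • ContinuousLinearMap.id ℂ (HJ J) -
    shiftHJ h).adjoint v : HJ J)) (g := v) hε fun i j => ?_
  by_cases hij : (i, j) ∈ J
  · refine le_trans (le_of_eq ?_) (hv i j hij)
    rw [adjoint_smul_id_sub, Submodule.coe_sub, Submodule.coe_smul, coeffT2_sub, coeffT2_smul,
      coeffT2_adjoint_shiftHJ h v hij]
  · rw [((μ • ContinuousLinearMap.id ℂ (HJ J) - shiftHJ h).adjoint v).2 i j hij, norm_zero]
    positivity

lemma mem_taylorSpectrum_of_approx (hJ : IsDiagram J) {μ l : ℂ}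
    (h : ∀ ε > 0, ∃ v : HJ J, v ≠ 0 ∧ ∀ i j, (i, j) ∈ J →
      ‖(starRingEnd ℂ) μ * coeffT2 v i j - coeffT2 v (i + 1) j‖ ≤ ε * ‖coeffT2 v i j‖ ∧
      ‖(starRingEnd ℂ) l * coeffT2 v i j - coeffT2 v i (j + 1)‖ ≤ ε * ‖coeffT2 v i j‖) :
    (μ, l) ∈ taylorSpectrum (Mw J hJ) (Mz J hJ) := by
  refine not_koszulExact_of_adjoint fun ε hε => ?_
  obtain ⟨v, hv, hvc⟩ := h ε hε
  refine ⟨v, hv, ?_, ?_⟩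
  · refine norm_adjoint_sub_shiftHJ_le (hJ.shiftsInto 1 0) μ hε.le fun i j hij => ?_
    simpa using (hvc i j hij).1
  · refine norm_adjoint_sub_shiftHJ_le (hJ.shiftsInto 0 1) l hε.le fun i j hij => ?_
    simpa using (hvc i j hij).2

lemma summable_pow_natAbs {t : ℝ} (h0 : 0 ≤ t) (h1 : t < 1) :
    Summable fun n : ℤ => t ^ n.natAbs := by
  refine Summable.of_nat_of_neg ?_ ?_ <;>
    simpa using summable_geometric_of_lt_one h0 h1

/-- Consecutive powers satisfy `t ^ n = (1 + ε) * t ^ (n + 1)`, so neighbouring weights differ by a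
relative error of at most `ε`, whichever way `|i|` moves. -/
lemma abs_one_sub_pow_natAbs_le {t ε : ℝ} (ht : t = 1 / (1 + ε)) (hε : 0 < ε) (i : ℤ) :
    |t ^ i.natAbs - t ^ (i + 1).natAbs| ≤ ε * t ^ i.natAbs := by
  have ht0 : 0 < t := by rw [ht]; positivity
  have e : t * (1 + ε) = 1 := by rw [ht]; field_simp
  have ht1 : t ≤ 1 := by nlinarith
  have hp (n : ℕ) : t ^ n = (1 + ε) * t ^ (n + 1) := by
    rw [pow_succ, mul_comm, mul_assoc, e, mul_one]
  rcases le_or_gt 0 i with hi | hi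
  · have : (i + 1).natAbs = i.natAbs + 1 := by lia
    have h2 := hp i.natAbs
    have h3 : t ^ (i.natAbs + 1) ≤ t ^ i.natAbs := pow_le_pow_of_le_one ht0.le ht1 (by lia)
    have h4 := mul_le_mul_of_nonneg_left h3 hε.le
    rw [this, abs_of_nonneg (by linarith)]
    linarith
  · have : i.natAbs = (i + 1).natAbs + 1 := by lia
    have h2 := hp (i + 1).natAbs
    have h3 : 0 ≤ ε * t ^ ((i + 1).natAbs + 1) := by positivity
    rw [this, h2, abs_of_nonpos (by linarith)]
    linarith

/-- A point of the closed bidisc with nonzero coordinates whose monomials are bounded by `1` on a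
diagram containing `(0, 0)` belongs to the Taylor spectrum. -/
lemma mem_taylorSpectrum_of_monomial_le (hJ : IsDiagram J) (hne : (0, 0) ∈ J) {μ l : ℂ}
    (hμ0 : μ ≠ 0) (hl0 : l ≠ 0) (hμ1 : ‖μ‖ ≤ 1) (hl1 : ‖l‖ ≤ 1)
    (hb : ∀ i j, (i, j) ∈ J → ‖μ‖ ^ i * ‖l‖ ^ j ≤ 1) :
    (μ, l) ∈ taylorSpectrum (Mw J hJ) (Mz J hJ) := by
  classical
  refine mem_taylorSpectrum_of_approx hJ fun ε hε => ?_
  obtain ⟨t, ht⟩ : ∃ t : ℝ, t = 1 / (1 + ε) := ⟨_, rfl⟩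
  have ht0 : 0 < t := by rw [ht]; positivity
  have ht1 : t < 1 := by rw [ht, div_lt_one] <;> linarith
  let m := (starRingEnd ℂ) μ
  let k := (starRingEnd ℂ) l
  have hm : ‖m‖ = ‖μ‖ := RCLike.norm_conj μ
  have hk : ‖k‖ = ‖l‖ := RCLike.norm_conj l
  have hm0 : m ≠ 0 := by rw [← norm_ne_zero_iff, hm]; exact norm_ne_zero_iff.2 hμ0
  have hk0 : k ≠ 0 := by rw [← norm_ne_zero_iff, hk]; exact norm_ne_zero_iff.2 hl0
  -- The formal joint eigenvector of the adjoints, damped by `t ^ (|i| + |j|)`.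
  let c : ℤ → ℤ → ℂ := fun i j =>
    if (i, j) ∈ J then m ^ i * k ^ j * ((t ^ i.natAbs * t ^ j.natAbs : ℝ) : ℂ) else 0
  have hcJ {i j : ℤ} (h : (i, j) ∈ J) :
      c i j = m ^ i * k ^ j * ((t ^ i.natAbs * t ^ j.natAbs : ℝ) : ℂ) := if_pos h
  have hcn {i j : ℤ} (h : (i, j) ∈ J) :
      ‖c i j‖ = ‖μ‖ ^ i * ‖l‖ ^ j * (t ^ i.natAbs * t ^ j.natAbs) := by
    rw [hcJ h, norm_mul, norm_mul, norm_zpow, norm_zpow, hm, hk, Complex.norm_real,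
      Real.norm_of_nonneg (by positivity)]
  have hsum : Summable fun n : ℤ × ℤ => ‖c n.1 n.2‖ ^ 2 := by
    have hs := summable_pow_natAbs ht0.le ht1
    refine Summable.of_nonneg_of_le (fun _ => by positivity) (fun n => ?_)
      (hs.mul_of_nonneg hs (fun _ => by positivity) (fun _ => by positivity))
    have h1 : t ^ n.1.natAbs * t ^ n.2.natAbs ≤ 1 :=
      mul_le_one₀ (pow_le_one₀ ht0.le ht1.le) (by positivity) (pow_le_one₀ ht0.le ht1.le)
    have h2 : ‖c n.1 n.2‖ ≤ t ^ n.1.natAbs * t ^ n.2.natAbs := by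
      by_cases hn : (n.1, n.2) ∈ J
      · rw [hcn hn]
        exact mul_le_of_le_one_left (by positivity) (hb _ _ hn)
      · rw [show c n.1 n.2 = 0 from if_neg hn, norm_zero]
        positivity
    rw [pow_two]
    exact (mul_le_of_le_one_left (norm_nonneg _) (h2.trans h1)).trans h2
  obtain ⟨v, hv⟩ := exists_coeffT2_eq hsum
  have hvJ : v ∈ HJ J := fun i j h => by rw [hv]; exact if_neg h
  refine ⟨⟨v, hvJ⟩, fun h0 => ?_, fun i j hij => ?_⟩
  · have h1 : v = 0 := congrArg Subtype.val h0
    have h2 := hv 0 0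
    rw [h1, hcJ hne, ← zero_smul ℂ (0 : L2T2), coeffT2_smul] at h2
    simp at h2
  · simp only [hv]
    have hw := hJ.shiftsInto 1 0 i j hij
    have hz := hJ.shiftsInto 0 1 i j hij
    norm_num at hw hz
    -- Shared by both directions: stepping to a neighbour changes the eigenvector relation only
    -- through the difference `d` of two weights.
    have hle (r : ℂ) (hr : ‖r‖ ≤ 1) (x : ℂ) (δ s : ℝ) (hs : 0 ≤ s) (d : ℝ)
        (hd : |d| ≤ ε * s) (hx : ‖x‖ * s = δ) : ‖r * x * (d : ℂ)‖ ≤ ε * δ := by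
      rw [norm_mul, norm_mul, Complex.norm_real, Real.norm_eq_abs, ← hx]
      calc ‖r‖ * ‖x‖ * |d| ≤ 1 * ‖x‖ * (ε * s) := by gcongr
        _ = _ := by ring
    have hx : ‖m ^ i * k ^ j‖ = ‖μ‖ ^ i * ‖l‖ ^ j := by
      rw [norm_mul, norm_zpow, norm_zpow, hm, hk]
    constructor
    · have := hle m (hm.trans_le hμ1) (m ^ i * k ^ j * ((t ^ j.natAbs : ℝ) : ℂ)) ‖c i j‖
        (t ^ i.natAbs) (by positivity) (t ^ i.natAbs - t ^ (i + 1).natAbs)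
        (abs_one_sub_pow_natAbs_le ht hε i) (by
          rw [hcn hij, norm_mul, hx, Complex.norm_real, Real.norm_of_nonneg (by positivity)]
          ring)
      convert this using 2
      rw [hcJ hij, hcJ hw, zpow_add₀ hm0, zpow_one]
      push_cast
      ring
    · have := hle k (hk.trans_le hl1) (m ^ i * k ^ j * ((t ^ i.natAbs : ℝ) : ℂ)) ‖c i j‖
        (t ^ j.natAbs) (by positivity) (t ^ j.natAbs - t ^ (j + 1).natAbs)
        (abs_one_sub_pow_natAbs_le ht hε j) (by
          rw [hcn hij, norm_mul, hx, Complex.norm_real, Real.norm_of_nonneg (by positivity)]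
          ring)
      convert this using 2
      rw [hcJ hij, hcJ hz, zpow_add₀ hk0, zpow_one]
      push_cast
      ring

/-- The origin belongs to the Taylor spectrum as soon as `J` has a minimal element. -/
lemma zero_mem_taylorSpectrum (hJ : IsDiagram J) {a b : ℤ} (hab : (a, b) ∈ J)
    (hw : (a - 1, b) ∉ J) (hz : (a, b - 1) ∉ J) :
    ((0 : ℂ), (0 : ℂ)) ∈ taylorSpectrum (Mw J hJ) (Mz J hJ) := by
  refine mem_taylorSpectrum_of_approx hJ fun ε hε => ?_
  obtain ⟨e, -, hec⟩ := exists_basisVector hab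
  refine ⟨e, ?_, fun i j hij => ?_⟩
  · rintro rfl
    have h2 := hec a b
    rw [Submodule.coe_zero, ← zero_smul ℂ (0 : L2T2), coeffT2_smul] at h2
    simp at h2
  · have h1 : coeffT2 e (i + 1) j = 0 := by
      rw [hec, if_neg]
      rw [Prod.mk.injEq]
      rintro ⟨rfl, rfl⟩
      exact hw (by simpa using hij)
    have h2 : coeffT2 e i (j + 1) = 0 := by
      rw [hec, if_neg]
      rw [Prod.mk.injEq]
      rintro ⟨rfl, rfl⟩
      exact hz (by simpa using hij)
    rw [h1, h2]
    simp only [map_zero, zero_mul, sub_zero, norm_zero]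
    exact ⟨by positivity, by positivity⟩

end Shift

/-! ### The wedge `{j ≥ -α i} ∩ {j ≥ -β i}` -/

section Wedge

variable {α β : ℝ}

lemma mem_twoLineDiagram (h : α ≤ β) {i j : ℤ} :
    (i, j) ∈ twoLineDiagram α β ↔ 0 ≤ α * i + j ∧ 0 ≤ β * i + j := by
  have e : (i, j) ∈ twoLineDiagram α β ↔
      (0 ≤ i → (j : ℝ) ≥ -α * i) ∧ (i < 0 → (j : ℝ) ≥ -β * i) := Iff.rfl
  rw [e]
  rcases le_or_gt 0 i with hi | hi
  · have hi' : (0 : ℝ) ≤ i := by exact_mod_cast hi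
    have := mul_le_mul_of_nonneg_right h hi'
    refine ⟨fun H => ?_, fun H => ⟨fun _ => by linarith, fun h' => by lia⟩⟩
    have := H.1 hi
    constructor <;> linarith
  · have hi' : (i : ℝ) ≤ 0 := by exact_mod_cast hi.le
    have := mul_le_mul_of_nonpos_right h hi'
    refine ⟨fun H => ?_, fun H => ⟨fun h' => by lia, fun _ => by linarith⟩⟩
    have := H.2 hi
    constructor <;> linarith

lemma twoLineDiagram_self (α : ℝ) : twoLineDiagram α α = lineDiagram α := by
  ext ⟨i, j⟩
  rw [mem_twoLineDiagram le_rfl, and_self]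
  change _ ↔ (j : ℝ) ≥ -α * i
  rw [ge_iff_le, neg_mul, neg_le_iff_add_nonneg, add_comm]

lemma shiftsInto_twoLineDiagram (h : α ≤ β) {a b : ℤ} (hα : 0 ≤ α * a + b) (hβ : 0 ≤ β * a + b) :
    ShiftsInto (twoLineDiagram α β) a b := by
  intro i j hij
  rw [mem_twoLineDiagram h] at hij ⊢
  push_cast
  constructor <;> linarith [hij.1, hij.2]

lemma isDiagram_twoLineDiagram (hα : 0 < α) (h : α ≤ β) : IsDiagram (twoLineDiagram α β) := by
  have hβ := hα.trans_le h
  intro i j hij k l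
  exact shiftsInto_twoLineDiagram h (by push_cast; positivity) (by push_cast; positivity) i j hij

/-- Take `q / p` a rational slightly below `α`. As `α ≠ 0`, `s ↦ y ^ s` is continuous at `α` even
for `y = 0`, so the strict inequality survives; then raise it to the power `p`. -/
lemma exists_rat_exponent_left (hα : 0 < α) {x y : ℝ} (hy : 0 ≤ y) (hlt : y ^ α < x) :
    ∃ p q : ℕ, (q : ℝ) ≤ α * p ∧ y ^ q < x ^ p := by
  have hc : ContinuousAt (fun s : ℝ => y ^ s) α := Real.continuousAt_const_rpow' hα.ne'
  have hev : ∀ᶠ s in 𝓝 α, 0 < s ∧ y ^ s < x :=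
    (lt_mem_nhds hα).and (hc.eventually_lt_const hlt)
  obtain ⟨u, hu, hsub⟩ := exists_Ioc_subset_of_mem_nhds hev ⟨0, hα⟩
  obtain ⟨r, hur, hrα⟩ := exists_rat_btwn hu
  obtain ⟨hr0, hr⟩ := hsub ⟨hur, hrα.le⟩
  have hr0' : (0 : ℚ) < r := by exact_mod_cast hr0
  have hden : (0 : ℝ) < r.den := by exact_mod_cast r.den_pos
  have hnum : ((r.num.toNat : ℕ) : ℝ) = r * r.den := by
    have h1 : ((r.num.toNat : ℤ)) = r.num := Int.toNat_of_nonneg (Rat.num_pos.2 hr0').le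
    have h2 : (r * r.den : ℚ) = r.num := Rat.mul_den_eq_num r
    have h3 : (r * r.den : ℝ) = r.num := by exact_mod_cast h2
    rw [h3]
    exact_mod_cast h1
  refine ⟨r.den, r.num.toNat, ?_, ?_⟩
  · rw [hnum]
    exact mul_le_mul_of_nonneg_right hrα.le hden.le
  · rw [← Real.rpow_natCast y, hnum, Real.rpow_mul hy, Real.rpow_natCast]
    exact pow_lt_pow_left₀ hr (by positivity) r.den_pos.ne'

lemma exists_rat_exponent_right (hβ : 0 < β) {x y : ℝ} (hx : 0 ≤ x) (hy : 0 ≤ y)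
    (hlt : x < y ^ β) : ∃ p q : ℕ, β * p ≤ q ∧ x ^ p < y ^ q := by
  have hc : ContinuousAt (fun s : ℝ => y ^ s) β := Real.continuousAt_const_rpow' hβ.ne'
  have hev : ∀ᶠ s in 𝓝 β, 0 < s ∧ x < y ^ s :=
    (lt_mem_nhds hβ).and (hc.eventually_const_lt hlt)
  obtain ⟨u, hu, hsub⟩ := exists_Ico_subset_of_mem_nhds hev ⟨β + 1, by linarith⟩
  obtain ⟨r, hrβ, hru⟩ := exists_rat_btwn hu
  obtain ⟨hr0, hr⟩ := hsub ⟨hrβ.le, hru⟩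
  have hr0' : (0 : ℚ) < r := by exact_mod_cast hr0
  have hden : (0 : ℝ) < r.den := by exact_mod_cast r.den_pos
  have hnum : ((r.num.toNat : ℕ) : ℝ) = r * r.den := by
    have h1 : ((r.num.toNat : ℤ)) = r.num := Int.toNat_of_nonneg (Rat.num_pos.2 hr0').le
    have h2 : (r * r.den : ℚ) = r.num := Rat.mul_den_eq_num r
    have h3 : (r * r.den : ℝ) = r.num := by exact_mod_cast h2
    rw [h3]
    exact_mod_cast h1
  refine ⟨r.den, r.num.toNat, ?_, ?_⟩
  · rw [hnum]
    exact mul_le_mul_of_nonneg_right hrβ.le hden.le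
  · rw [← Real.rpow_natCast y, hnum, Real.rpow_mul hy, Real.rpow_natCast]
    exact pow_lt_pow_left₀ hr hx r.den_pos.ne'

/-- Replace `x` by `y ^ α` if `i ≥ 0` and by `y ^ β` if `i < 0`; both increase `x ^ i`, and what
remains is a nonnegative power of `y ≤ 1`. -/
lemma monomial_le_one (h : α ≤ β) {x y : ℝ} (hx : 0 < x) (hy : 0 < y)
    (hy1 : y ≤ 1) (h₁ : y ^ β ≤ x) (h₂ : x ≤ y ^ α) {i j : ℤ}
    (hij : (i, j) ∈ twoLineDiagram α β) : x ^ i * y ^ j ≤ 1 := by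
  rw [mem_twoLineDiagram h] at hij
  have key (γ : ℝ) (hγ : 0 ≤ γ * i + j) (hle : x ^ i ≤ (y ^ γ) ^ i) : x ^ i * y ^ j ≤ 1 := by
    calc x ^ i * y ^ j ≤ (y ^ γ) ^ i * y ^ j := by gcongr
      _ = y ^ (γ * i + j) := by
        rw [Real.rpow_add hy, Real.rpow_mul hy.le, Real.rpow_intCast, Real.rpow_intCast]
      _ ≤ 1 := Real.rpow_le_one hy.le hy1 hγ
  rcases le_or_gt 0 i with hi | hi
  · exact key α hij.1 (zpow_le_zpow_left₀ hi hx.le h₂)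
  · refine key β hij.2 ?_
    have := zpow_le_zpow_left₀ (n := -i) (by lia) (by positivity) h₁
    rw [zpow_neg, zpow_neg] at this
    exact (inv_le_inv₀ (by positivity) (by positivity)).1 this

/-- The Taylor spectrum of the pair defined by a wedge. -/
theorem taylorSpectrum_twoLineDiagram (hα : 0 < α) (h : α ≤ β)
    (hJ : IsDiagram (twoLineDiagram α β)) :
    taylorSpectrum (Mw (twoLineDiagram α β) hJ) (Mz (twoLineDiagram α β) hJ) =
      {p : ℂ × ℂ | ‖p.1‖ ≤ 1 ∧ ‖p.2‖ ≤ 1 ∧ ‖p.2‖ ^ β ≤ ‖p.1‖ ∧ ‖p.1‖ ≤ ‖p.2‖ ^ α} := by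
  have hβ := hα.trans_le h
  ext ⟨μ, l⟩
  constructor
  · intro hp
    obtain ⟨h1, h2⟩ := taylorSpectrum_subset_bidisc hJ hp
    refine ⟨h1, h2, ?_, ?_⟩ <;> by_contra! hlt
    · obtain ⟨p, q, hpq, hlt'⟩ :=
        exists_rat_exponent_right hβ (norm_nonneg μ) (norm_nonneg l) hlt
      refine notMem_taylorSpectrum_of_shift_right hJ (p := p) (q := q) ?_ hlt' hp
      have := mul_le_mul_of_nonneg_right h (Nat.cast_nonneg p : (0 : ℝ) ≤ p)
      exact shiftsInto_twoLineDiagram h (by push_cast; linarith) (by push_cast; linarith)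
    · obtain ⟨p, q, hpq, hlt'⟩ := exists_rat_exponent_left hα (norm_nonneg l) hlt
      refine notMem_taylorSpectrum_of_shift_left hJ (p := p) (q := q) ?_ hlt' hp
      have := mul_le_mul_of_nonneg_right h (Nat.cast_nonneg p : (0 : ℝ) ≤ p)
      exact shiftsInto_twoLineDiagram h (by push_cast; linarith) (by push_cast; linarith)
  · rintro ⟨h1, h2, h3, h4⟩
    dsimp only at h1 h2 h3 h4
    have h00 : (0, 0) ∈ twoLineDiagram α β := by simp [mem_twoLineDiagram h]
    -- If `l = 0`, the upper inequality forces `μ = 0`; if `l ≠ 0`, the lower one forces `μ ≠ 0`.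
    by_cases hl : l = 0
    · obtain rfl : μ = 0 := by
        rw [hl, norm_zero, Real.zero_rpow hα.ne'] at h4
        exact norm_le_zero_iff.1 h4
      rw [hl]
      refine zero_mem_taylorSpectrum hJ h00 ?_ ?_ <;> rw [mem_twoLineDiagram h] <;> push_cast <;>
        intro H <;> linarith [H.1]
    · have hl' : 0 < ‖l‖ := norm_pos_iff.2 hl
      have hμ' : 0 < ‖μ‖ := (Real.rpow_pos_of_pos hl' β).trans_le h3
      exact mem_taylorSpectrum_of_monomial_le hJ h00 (norm_pos_iff.1 hμ') hl h1 h2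
        fun i j hij => monomial_le_one h hμ' hl' h2 h3 h4 hij

/-- By Fubini: for fixed second coordinate the fibre is a circle, a null set of the plane. -/
lemma volume_rpow_curve (α : ℝ) :
    volume {p : ℂ × ℂ | ‖p.1‖ ≤ 1 ∧ ‖p.2‖ ≤ 1 ∧ ‖p.2‖ ^ α = ‖p.1‖} = 0 := by
  have hm : MeasurableSet {p : ℂ × ℂ | ‖p.2‖ ^ α = ‖p.1‖} :=
    measurableSet_eq_fun (measurable_snd.norm.pow_const α) measurable_fst.norm
  refine measure_mono_null (t := {p : ℂ × ℂ | ‖p.2‖ ^ α = ‖p.1‖}) (fun p hp => hp.2.2) ?_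
  rw [Measure.volume_eq_prod, Measure.prod_apply_symm hm]
  have hz (l : ℂ) : volume ((fun μ : ℂ => (μ, l)) ⁻¹' {p : ℂ × ℂ | ‖p.2‖ ^ α = ‖p.1‖}) = 0 := by
    have e : (fun μ : ℂ => (μ, l)) ⁻¹' {p : ℂ × ℂ | ‖p.2‖ ^ α = ‖p.1‖} =
        Metric.sphere (0 : ℂ) (‖l‖ ^ α) := by
      ext μ
      simp [eq_comm]
    rw [e, Measure.addHaar_sphere]
  simp only [hz, lintegral_zero]

/-! ### The growth parameters -/

lemma rowStart_twoLineDiagram (hα : 0 < α) (h : α ≤ β) (j : ℤ) :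
    rowStart (twoLineDiagram α β) j = (((⌈max (-j / α) (-j / β)⌉ : ℤ) : ℝ) : EReal) := by
  have hβ := hα.trans_le h
  have hmem (i : ℤ) : (i, j) ∈ twoLineDiagram α β ↔ ⌈max (-j / α : ℝ) (-j / β)⌉ ≤ i := by
    rw [mem_twoLineDiagram h, Int.ceil_le, max_le_iff, div_le_iff₀ hα, div_le_iff₀ hβ,
      neg_le_iff_add_nonneg, neg_le_iff_add_nonneg, mul_comm α, mul_comm β]
  apply le_antisymm
  · exact iInf_le_of_le ⟨_, (hmem _).2 le_rfl⟩ le_rfl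
  · refine le_iInf fun i => ?_
    exact_mod_cast (hmem i).1 i.2

/-- Uniformly bounded deviations from `n * c` give the limit `c` for suprema and infima of
averages. -/
lemma tendsto_iSup_iInf_div {ι : Type*} [Nonempty ι] {f : ℕ → ι → ℝ} {c C : ℝ}
    (hf : ∀ n i, |f n i - n * c| ≤ C) :
    Tendsto (fun n : ℕ => ⨆ i, ((f n i : ℝ) : EReal) / (n : EReal)) atTop (𝓝 (c : EReal)) ∧
    Tendsto (fun n : ℕ => ⨅ i, ((f n i : ℝ) : EReal) / (n : EReal)) atTop (𝓝 (c : EReal)) := by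
  have hlim (s : ℝ) : Tendsto (fun n : ℕ => ((c + s / n : ℝ) : EReal)) atTop (𝓝 (c : EReal)) := by
    refine (continuous_coe_real_ereal.tendsto c).comp ?_
    simpa using (tendsto_const_div_atTop_nhds_zero_nat s).const_add c
  have hbd (n : ℕ) (hn : 0 < n) (i : ι) :
      ((c + (-C) / n : ℝ) : EReal) ≤ ((f n i : ℝ) : EReal) / (n : EReal) ∧
      ((f n i : ℝ) : EReal) / (n : EReal) ≤ ((c + C / n : ℝ) : EReal) := by
    have hn' : (0 : ℝ) < n := by exact_mod_cast hn
    have e : ((f n i : ℝ) : EReal) / (n : EReal) = ((f n i / n : ℝ) : EReal) := by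
      rw [EReal.coe_div]; rfl
    rw [e, EReal.coe_le_coe_iff, EReal.coe_le_coe_iff, div_le_iff₀ hn', le_div_iff₀ hn', add_mul,
      add_mul, div_mul_cancel₀ _ hn'.ne', div_mul_cancel₀ _ hn'.ne']
    obtain ⟨h1, h2⟩ := abs_le.1 (hf n i)
    constructor <;> linarith
  obtain ⟨i₀⟩ := ‹Nonempty ι›
  constructor <;> refine tendsto_of_tendsto_of_tendsto_of_le_of_le' (hlim (-C)) (hlim C) ?_ ?_ <;>
    filter_upwards [eventually_gt_atTop 0] with n hn
  · exact le_iSup_of_le i₀ (hbd n hn i₀).1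
  · exact iSup_le fun i => (hbd n hn i).2
  · exact le_iInf fun i => (hbd n hn i).1
  · exact iInf_le_of_le i₀ (hbd n hn i₀).2

variable {J : Set (ℤ × ℤ)} {M : ℤ → ℤ}

lemma rowFinite_of_eq (hM : ∀ j, rowStart J j = ((M j : ℝ) : EReal)) (j : ℤ) : RowFinite J j := by
  rw [RowFinite, hM]
  exact ⟨EReal.coe_ne_bot _, EReal.coe_ne_top _⟩

lemma isRhoMinus_isDeltaMinus (hM : ∀ j, rowStart J j = ((M j : ℝ) : EReal)) {c : ℝ}
    (hc : ∀ j₀ : ℤ, ∃ C : ℝ, ∀ j ≤ j₀, |(M j : ℝ) + c * j| ≤ C) :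
    IsRhoMinus J (c : EReal) ∧ IsDeltaMinus J (c : EReal) := by
  have hfin := rowFinite_of_eq hM
  choose C hC using hc
  have key (j₀ : ℤ) :=
    haveI : Nonempty {j : ℤ // j ≤ j₀} := ⟨⟨j₀, le_rfl⟩⟩
    -- The deviation is a difference of the errors `M j + c * j` at two rows, hence the doubled
    -- constant.
    tendsto_iSup_iInf_div (ι := {j : ℤ // j ≤ j₀}) (c := c) (C := C j₀ + C j₀)
      (f := fun n j => (M (j - n) : ℝ) - M j) fun n j => by
        have h1 := hC j₀ (j - n) (by have := j.2; lia)
        have h2 := hC j₀ j j.2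
        rw [abs_le] at h1 h2 ⊢
        push_cast at h1
        constructor <;> linarith [h1.1, h1.2, h2.1, h2.2]
  refine ⟨Or.inr ⟨fun j => (hfin j).2, ⟨0, fun j _ => hfin j⟩, fun j₀ _ => ?_⟩,
    Or.inr ⟨fun j => (hfin j).2, ⟨0, fun j _ => hfin j⟩, fun j₀ _ => ?_⟩⟩
  · simpa only [hM, ← EReal.coe_sub] using (key j₀).1
  · simpa only [hM, ← EReal.coe_sub] using (key j₀).2

lemma isRhoPlus_isDeltaPlus (hM : ∀ j, rowStart J j = ((M j : ℝ) : EReal)) {c : ℝ}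
    (hc : ∀ j₁ : ℤ, ∃ C : ℝ, ∀ j ≥ j₁, |(M j : ℝ) + c * j| ≤ C) :
    IsRhoPlus J (c : EReal) ∧ IsDeltaPlus J (c : EReal) := by
  have hfin := rowFinite_of_eq hM
  choose C hC using hc
  have key (j₁ : ℤ) :=
    haveI : Nonempty {j : ℤ // j ≥ j₁} := ⟨⟨j₁, le_rfl⟩⟩
    tendsto_iSup_iInf_div (ι := {j : ℤ // j ≥ j₁}) (c := c) (C := C j₁ + C j₁)
      (f := fun n j => (M j : ℝ) - M (j + n)) fun n j => by
        have h1 := hC j₁ (j + n) (by have := j.2; lia)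
        have h2 := hC j₁ j j.2
        rw [abs_le] at h1 h2 ⊢
        push_cast at h1
        constructor <;> linarith [h1.1, h1.2, h2.1, h2.2]
  refine ⟨Or.inr ⟨fun j => (hfin j).1, ⟨0, fun j _ => hfin j⟩, fun j₁ _ => ?_⟩,
    Or.inr ⟨fun j => (hfin j).1, ⟨0, fun j _ => hfin j⟩, fun j₁ _ => ?_⟩⟩
  · simpa only [hM, ← EReal.coe_sub] using (key j₁).1
  · simpa only [hM, ← EReal.coe_sub] using (key j₁).2

lemma twoLineDiagram_minus (hα : 0 < α) (h : α ≤ β) :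
    IsRhoMinus (twoLineDiagram α β) ((1 / α : ℝ) : EReal) ∧
      IsDeltaMinus (twoLineDiagram α β) ((1 / α : ℝ) : EReal) := by
  have hβ := hα.trans_le h
  -- The 1 pays for the ceiling; `|j₀| / α` pays for the rows `0 < j ≤ j₀`, where the maximum is `-j
  -- / β`.
  refine isRhoMinus_isDeltaMinus (rowStart_twoLineDiagram hα h) fun j₀ =>
    ⟨1 + |(j₀ : ℝ)| / α, fun j hj => ?_⟩
  have hj' : (j : ℝ) ≤ |(j₀ : ℝ)| := (by exact_mod_cast hj : (j : ℝ) ≤ j₀).trans (le_abs_self _)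
  have h1 := Int.le_ceil (max (-j / α : ℝ) (-j / β))
  have h2 := Int.ceil_lt_add_one (max (-j / α : ℝ) (-j / β))
  have h3 : max (-j / α : ℝ) (-j / β) ≤ -j / α + |(j₀ : ℝ)| / α := by
    refine max_le (le_add_of_nonneg_right (by positivity)) ?_
    rw [← add_div]
    rcases le_or_gt j 0 with h0 | h0
    · have h0' : (0 : ℝ) ≤ -j := by
        rw [neg_nonneg]; exact_mod_cast h0
      exact div_le_div₀ (by positivity) (by linarith [abs_nonneg (j₀ : ℝ)]) hα h
    · have h0' : (0 : ℝ) < j := by exact_mod_cast h0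
      exact (div_nonpos_of_nonpos_of_nonneg (by linarith) hβ.le).trans
        (div_nonneg (by linarith) hα.le)
  have h4 := le_max_left (-j / α : ℝ) (-j / β)
  have e : (1 / α * j : ℝ) = -(-j / α) := by ring
  have h5 : 0 ≤ |(j₀ : ℝ)| / α := by positivity
  rw [e, abs_le]
  constructor <;> linarith

lemma twoLineDiagram_plus (hα : 0 < α) (h : α ≤ β) :
    IsRhoPlus (twoLineDiagram α β) ((1 / β : ℝ) : EReal) ∧
      IsDeltaPlus (twoLineDiagram α β) ((1 / β : ℝ) : EReal) := by
  have hβ := hα.trans_le h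
  -- Here `|j₁| / α` pays for the rows `j₁ ≤ j < 0`, where the maximum is `-j / α`.
  refine isRhoPlus_isDeltaPlus (rowStart_twoLineDiagram hα h) fun j₁ =>
    ⟨1 + |(j₁ : ℝ)| / α, fun j hj => ?_⟩
  have hj' : (j₁ : ℝ) ≤ j := by exact_mod_cast hj
  have hj'' : -(j : ℝ) ≤ |(j₁ : ℝ)| := (neg_le_neg hj').trans (neg_le_abs _)
  have h1 := Int.le_ceil (max (-j / α : ℝ) (-j / β))
  have h2 := Int.ceil_lt_add_one (max (-j / α : ℝ) (-j / β))
  have h3 : max (-j / α : ℝ) (-j / β) ≤ -j / β + |(j₁ : ℝ)| / α := by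
    refine max_le ?_ (le_add_of_nonneg_right (by positivity))
    rcases le_or_gt j 0 with h0 | h0
    · have h0' : (0 : ℝ) ≤ -j := by
        rw [neg_nonneg]; exact_mod_cast h0
      have : -(j : ℝ) / α ≤ |(j₁ : ℝ)| / α := div_le_div_of_nonneg_right hj'' hα.le
      have : 0 ≤ -(j : ℝ) / β := by positivity
      linarith
    · have h0' : (0 : ℝ) < j := by exact_mod_cast h0
      have : (j : ℝ) / β ≤ j / α := div_le_div_of_nonneg_left h0'.le hα h
      have : 0 ≤ |(j₁ : ℝ)| / α := by positivity
      rw [neg_div, neg_div]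
      linarith
  have h4 := le_max_right (-j / α : ℝ) (-j / β)
  have e : (1 / β * j : ℝ) = -(-j / β) := by ring
  have h5 : 0 ≤ |(j₁ : ℝ)| / α := by positivity
  rw [e, abs_le]
  constructor <;> linarith

end Wedge

end DiagramPair

open DiagramPair in
theorem mainTheorem7 :
    (∀ α : ℝ, 0 < α →
      ∃ hJ : IsDiagram (lineDiagram α),
        IsRhoPlus (lineDiagram α) ((1 / α : ℝ) : EReal) ∧
        IsRhoMinus (lineDiagram α) ((1 / α : ℝ) : EReal) ∧
        IsDeltaPlus (lineDiagram α) ((1 / α : ℝ) : EReal) ∧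
        IsDeltaMinus (lineDiagram α) ((1 / α : ℝ) : EReal) ∧
        taylorSpectrum (Mw (lineDiagram α) hJ) (Mz (lineDiagram α) hJ) =
          {p : ℂ × ℂ | ‖p.1‖ ≤ 1 ∧ ‖p.2‖ ≤ 1 ∧ ‖p.2‖ ^ α = ‖p.1‖} ∧
        MeasureTheory.volume
          (taylorSpectrum (Mw (lineDiagram α) hJ) (Mz (lineDiagram α) hJ)) = 0) ∧
    (∀ α β : ℝ, 0 < α → α < β →
      ∃ hJ : IsDiagram (twoLineDiagram α β),
        IsRhoMinus (twoLineDiagram α β) ((1 / α : ℝ) : EReal) ∧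
        IsDeltaMinus (twoLineDiagram α β) ((1 / α : ℝ) : EReal) ∧
        IsRhoPlus (twoLineDiagram α β) ((1 / β : ℝ) : EReal) ∧
        IsDeltaPlus (twoLineDiagram α β) ((1 / β : ℝ) : EReal) ∧
        taylorSpectrum (Mw (twoLineDiagram α β) hJ) (Mz (twoLineDiagram α β) hJ) =
          {p : ℂ × ℂ | ‖p.1‖ ≤ 1 ∧ ‖p.2‖ ≤ 1 ∧
            ‖p.2‖ ^ β ≤ ‖p.1‖ ∧ ‖p.1‖ ≤ ‖p.2‖ ^ α}) := by
  refine ⟨fun α hα => ?_, fun α β hα h => ?_⟩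
  · rw [← twoLineDiagram_self α]
    have hs (hJ : IsDiagram (twoLineDiagram α α)) :
        taylorSpectrum (Mw (twoLineDiagram α α) hJ) (Mz (twoLineDiagram α α) hJ) =
          {p : ℂ × ℂ | ‖p.1‖ ≤ 1 ∧ ‖p.2‖ ≤ 1 ∧ ‖p.2‖ ^ α = ‖p.1‖} := by
      -- For `β = α` the two inequalities collapse to an equality.
      simpa only [← le_antisymm_iff] using taylorSpectrum_twoLineDiagram hα le_rfl hJ
    have hm := twoLineDiagram_minus hα (le_refl α)
    have hp := twoLineDiagram_plus hα (le_refl α)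
    refine ⟨isDiagram_twoLineDiagram hα le_rfl, hp.1, hm.1, hp.2, hm.2, hs _, ?_⟩
    rw [hs]
    exact volume_rpow_curve α
  · have hm := twoLineDiagram_minus hα h.le
    have hp := twoLineDiagram_plus hα h.le
    exact ⟨isDiagram_twoLineDiagram hα h.le, hm.1, hm.2, hp.1, hp.2,
      taylorSpectrum_twoLineDiagram hα h.le _⟩
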